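/- **Conventions.** For a topological group $\Gamma$, a *$\Gamma$-space* is a nonempty compact Hausdorff space with a continuous action of $\Gamma$. It is *minimal* if its only closed $\Gamma$-invariant subsets are $\emptyset$ and the whole space, and *universal* if every minimal $\Gamma$-space is the image of it under a continuous $\Gamma$-equivariant surjection. The *universal minimal space* of $\Gamma$ is the (unique up to isomorphism) $\Gamma$-space that is both minimal and universal. For a subgroup $H\subseteq\Gamma$, the pair $(\Gamma,H)$ is *relatively extremely amenable* if every $\Gamma$-space has an $H$-fixed point. For a $\Gamma$-space $X$ put $\mathrm{Fix}_X(H)=\{x\in X: hx=x\ \forall h\in H\}$; a set $Y\subseteq X$ is *transitive with respect to $X$* if $\overline{\Gamma y}=X$ for every $y\in Y$. A *Fraïssé class* in a countable first-order signature is a nonempty class of finite structures, with countably many isomorphism types, that has the hereditary, joint embedding and amalgamation properties; its *Fraïssé limit* $\mathrm{Flim}$ is the (unique up to isomorphism) countable ultrahomogeneous structure whose finitely generated substructures are, up to isomorphism, exactly the members of the class. Let $L$ be a countable signature with a distinguished binary relation symbol $<$, let $L_0=L\setminus\{<\}$, and let $K_0$ be a Fraïssé class in $L_0$. An *order Fraïssé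 expansion* of $K_0$ in $L$ is a Fraïssé class $K$ in $L$ such that $<$ is interpreted by a (strict) linear order in every member of $K$, such that $K_0=\{A|L_0: A\in K\}$, and which is *reasonable*: for all $A_0,B_0\in K_0$, every embedding $\pi:A_0\to B_0$ and every linear order $\prec$ on $A_0$ with $\langle A_0,\prec\rangle\in K$, there is a linear order $\prec'$ on $B_0$ with $\langle B_0,\prec'\rangle\in K$ and $a\prec b\Leftrightarrow\pi(a)\prec'\pi(b)$ for all $a,b\in A_0$. **Theorem.** Let $K$ be an order Fraïssé expansion of a Fraïssé class $K_0$, let $F=\mathrm{Flim}(K)$, let $<_0$ be the linear order that interprets $<$ in $F$, and let $F_0=F|L_0$. Then $F_0=\mathrm{Flim}(K_0)$. Let $G_0=\mathrm{Aut}(F_0)$, with the topology of pointwise convergence ($F$ being discrete), let $G=\mathrm{Aut}(F)\subseteq G_0$, let $LO(F)\subseteq\{0,1\}^{F\times F}$ be the compact space of linear orders on the set $F$, on which $G_0$ acts by $a\,(g\prec)\,b\Leftrightarrow g^{-1}a\prec g^{-1}b$, and let $X_K=\overline{G_0<_0}\subseteq LO(F)$. Then $X_K$ is the universal minimal space of $G_0$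 if and only if $(G_0,G)$ is relatively extremely amenable and $\mathrm{Fix}_{X_K}(G)$ is transitive with respect to $X_K$. -/

import Mathlib

open FirstOrder.Language CategoryTheory
open scoped FirstOrder

universe u v w s

namespace RelExtAmenability

/-! ### Topological dynamics -/

section Dynamics

/-- `X` is a `G`-space: a (nonempty) compact Hausdorff space with a continuous action of `G`. -/
structure IsGSpace (G : Type*) [Group G] [TopologicalSpace G]
    (X : Type*) [TopologicalSpace X] [MulAction G X] : Prop where
  nonempty : Nonempty X
  compact : CompactSpace X
  hausdorff : T2Space X
  continuous_smul : ContinuousSMul G X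

/-- The pair `(G, H)` is relatively extremely amenable: every `G`-space has an `H`-fixed point. -/
def RelativelyExtremelyAmenable (G : Type*) [Group G] [TopologicalSpace G]
    (H : Subgroup G) : Prop :=
  ∀ (X : Type s) [TopologicalSpace X] [MulAction G X], IsGSpace G X →
    ∃ x : X, ∀ h ∈ H, h • x = x

/-- A minimal `G`-space: the only closed invariant subsets are `∅` and the whole space. -/
structure IsMinimalGSpace (G : Type*) [Group G] [TopologicalSpace G]
    (X : Type*) [TopologicalSpace X] [MulAction G X] : Prop where
  isGSpace : IsGSpace G X
  minimal : ∀ C : Set X, IsClosed C → (∀ g : G, ∀ x ∈ C, g • x ∈ C) → C = ∅ ∨ C = Set.univ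

/-- `Y` is a `G`-factor of `X`. -/
def IsFactor (G : Type*) [Group G] (X Y : Type*) [TopologicalSpace X] [MulAction G X]
    [TopologicalSpace Y] [MulAction G Y] : Prop :=
  ∃ φ : X → Y, Continuous φ ∧ Function.Surjective φ ∧ ∀ (g : G) (x : X), φ (g • x) = g • φ x

/-- A universal `G`-space: every minimal `G`-space is a factor of it. -/
structure IsUniversalGSpace (G : Type*) [Group G] [TopologicalSpace G]
    (X : Type*) [TopologicalSpace X] [MulAction G X] : Prop where
  isGSpace : IsGSpace G X
  universal : ∀ (Y : Type s) [TopologicalSpace Y] [MulAction G Y],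
    IsMinimalGSpace G Y → IsFactor G X Y

/-- `X` is the universal minimal space of `G` (which is unique up to isomorphism): it is a `G`-space
which is both minimal and universal. -/
structure IsUniversalMinimalSpace (G : Type*) [Group G] [TopologicalSpace G]
    (X : Type*) [TopologicalSpace X] [MulAction G X] : Prop where
  isMinimal : IsMinimalGSpace G X
  isUniversal : IsUniversalGSpace.{s} G X

/-- `Fix_X(H)`, the set of `H`-fixed points of `X`. -/
def fixSet {G : Type*} [Group G] (H : Subgroup G) (X : Type*) [MulAction G X] : Set X :=
  {x | ∀ h ∈ H, h • x = x}

/-- `Y ⊆ X` is transitive with respect to `X`: every point of `Y` has dense `G`-orbit in `X`. -/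
def IsTransitiveWrt (G : Type*) [Group G] {X : Type*} [TopologicalSpace X] [MulAction G X]
    (Y : Set X) : Prop :=
  ∀ y ∈ Y, closure (MulAction.orbit G y) = Set.univ

end Dynamics

/-! ### The space of linear orders -/

section Orders

/-- The topology of pointwise convergence on the permutation group of a (discrete) set `M`:
the coarsest one for which `σ ↦ σ a` is continuous for all `a`, with `M` discrete. -/
instance permTopology (M : Type w) : TopologicalSpace (Equiv.Perm M) :=
  ⨅ a : M, TopologicalSpace.induced (fun σ : Equiv.Perm M => σ a) ⊥

/-- `LO(M) ⊆ {0,1}^(M × M)`, the space of strict linear orders on `M`, with the topology of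
pointwise convergence (the subspace topology of the product topology). -/
def LO (M : Type w) : Type w :=
  {r : M × M → Bool // IsStrictTotalOrder M (fun a b => r (a, b) = true)}

instance (M : Type w) : TopologicalSpace (LO M) :=
  inferInstanceAs (TopologicalSpace {r : M × M → Bool //
    IsStrictTotalOrder M (fun a b => r (a, b) = true)})

/-- The linear order, as a relation, given by a point of `LO(M)`. -/
def LO.rel {M : Type w} (r : LO M) : M → M → Prop := fun a b => r.1 (a, b) = true

/-- The logic action: `a (σ • r) b` if and only if `(σ⁻¹ a) r (σ⁻¹ b)`. -/
instance (M : Type w) : MulAction (Equiv.Perm M) (LO M) where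
  smul σ r := ⟨fun p => r.1 (σ⁻¹ p.1, σ⁻¹ p.2),
    haveI := r.2
    (RelEmbedding.preimage (σ⁻¹ : Equiv.Perm M).toEmbedding
      (fun a b => r.1 (a, b) = true)).isStrictTotalOrder⟩
  one_smul _ := rfl
  mul_smul _ _ _ := rfl

theorem continuous_perm_smul {M : Type w} (σ : Equiv.Perm M) :
    Continuous (fun r : LO M => σ • r) :=
  Continuous.subtype_mk
    (continuous_pi fun p => (continuous_apply (σ⁻¹ p.1, σ⁻¹ p.2)).comp continuous_subtype_val) _

/-- The closure in `LO(M)` of the orbit of `r` under a group `H` of permutations of `M`,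
with the action of `H`. -/
def orbitClosure {M : Type w} (H : Subgroup (Equiv.Perm M)) (r : LO M) :
    SubMulAction H (LO M) where
  carrier := closure (MulAction.orbit H r)
  smul_mem' g x hx := by
    refine map_mem_closure (f := fun y : LO M => g • y)
      (continuous_perm_smul (g : Equiv.Perm M)) hx ?_
    intro y hy
    exact MulAction.mem_orbit_of_mem_orbit g hy

end Orders

/-! ### Fraïssé classes and order expansions -/

section Fraisse

/-- The group of automorphisms of the structure `S` on `M`, as a group of permutations of `M`. -/
def autGroup (L : FirstOrder.Language.{u, v}) {M : Type w} (S : L.Structure M) :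
    Subgroup (Equiv.Perm M) where
  carrier := {σ | ∃ e : M ≃[L] M, e.toEquiv = σ}
  one_mem' := ⟨FirstOrder.Language.Equiv.refl L M, rfl⟩
  mul_mem' := by
    rintro _ _ ⟨e, rfl⟩ ⟨f, rfl⟩
    exact ⟨e.comp f, rfl⟩
  inv_mem' := by
    rintro _ ⟨e, rfl⟩
    exact ⟨e.symm, rfl⟩

/-- The symbols of the signature `{<}`. -/
inductive LtRel : ℕ → Type
  | lt : LtRel 2

/-- The signature `{<}`, with one binary relation symbol. -/
def ltLang : FirstOrder.Language.{0, 0} := ⟨fun _ => Empty, LtRel⟩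

instance (L₀ : FirstOrder.Language.{u, v}) [Countable (Σ l, L₀.Functions l)] :
    Countable (Σ l, (L₀.sum ltLang).Functions l) := by
  let f : (Σ l, L₀.Functions l) → Σ l, (L₀.sum ltLang).Functions l :=
    fun x => ⟨x.1, Sum.inl x.2⟩
  refine Function.Surjective.countable (f := f) ?_
  rintro ⟨l, x | x⟩
  · exact ⟨⟨l, x⟩, rfl⟩
  · exact x.elim

/-- The interpretation of `<` by the relation `r`. -/
@[reducible] def ltStructure {M : Type w} (r : M → M → Prop) : ltLang.Structure M where
  funMap f _ := f.elim
  RelMap R x := match R with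
    | LtRel.lt => r (x 0) (x 1)

variable {L₀ : FirstOrder.Language.{u, v}}

/-- The structure `⟨M, r⟩` in the signature `L = L₀ ∪ {<}`, for an `L₀`-structure `M` and a binary
relation `r` on `M`. -/
@[reducible] def expand {M : Type w} (S₀ : L₀.Structure M) (r : M → M → Prop) :
    (L₀.sum ltLang).Structure M :=
  letI := ltStructure r
  FirstOrder.Language.sumStructure L₀ ltLang M

/-- The interpretation of the symbol `<` in an `L`-structure. -/
def ltOf {M : Type w} (S : (L₀.sum ltLang).Structure M) : M → M → Prop :=
  fun a b => S.RelMap (Sum.inr LtRel.lt) ![a, b]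

/-- The reduct `A ↦ A|L₀`. -/
def reduct (A : Bundled.{w} (L₀.sum ltLang).Structure) : Bundled.{w} L₀.Structure :=
  ⟨A, (LHom.sumInl : L₀ →ᴸ L₀.sum ltLang).reduct A⟩

/-- A Fraïssé class of finite structures. -/
structure IsFraisseClass {L : FirstOrder.Language.{u, v}} (K : Set (Bundled.{w} L.Structure)) : Prop where
  isFraisse : IsFraisse K
  finite : ∀ A ∈ K, Finite A

/-- `K` is an order Fraïssé expansion of `K₀`: it is a Fraïssé class in `L = L₀ ∪ {<}` all of
whose members interpret `<` as a linear order, its class of `L₀`-reducts is `K₀`, and it is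
reasonable: admissible orders on `A₀` extend to admissible orders along all embeddings
`A₀ → B₀` in `K₀`. -/
structure IsOrderFraisseExpansion (K₀ : Set (Bundled.{w} L₀.Structure))
    (K : Set (Bundled.{w} (L₀.sum ltLang).Structure)) : Prop where
  isFraisseClass : IsFraisseClass K
  isOrderClass : ∀ A ∈ K, IsStrictTotalOrder A (ltOf A.str)
  reducts : reduct '' K = K₀
  reasonable : ∀ A₀ ∈ K₀, ∀ B₀ ∈ K₀, ∀ (π : A₀ ↪[L₀] B₀) (r : A₀ → A₀ → Prop),
    IsStrictTotalOrder A₀ r → ⟨A₀, expand A₀.str r⟩ ∈ K →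
    ∃ r' : B₀ → B₀ → Prop, IsStrictTotalOrder B₀ r' ∧ ⟨B₀, expand B₀.str r'⟩ ∈ K ∧
      ∀ a b : A₀, r a b ↔ r' (π a) (π b)

/-- The structure `S` on the countable set `M` is the Fraïssé limit of `K`
(which is unique up to isomorphism). -/
def IsFlim {L : FirstOrder.Language.{u, v}} [Countable (Σ l, L.Functions l)]
    (K : Set (Bundled.{w} L.Structure)) {M : Type w} [Countable M] (S : L.Structure M) : Prop :=
  IsFraisseLimit K M

end Fraisse

end RelExtAmenability

open RelExtAmenability

/-! Reasonableness lets an order pulled back from `<₀` extend to one more point, so ultrahomogeneity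
of `F` passes to `F₀`. If `X_K` is universal and minimal, it maps equivariantly to a minimal
subspace of any `G₀`-space, and the image of the `G`-fixed point `<₀` is `G`-fixed; transitivity is
immediate from minimality. Conversely, a nonempty closed invariant subset of `X_K` contains a
`G`-fixed point by relative extreme amenability, and that point has dense orbit, so `X_K` is
minimal. For universality, take a `G`-fixed point `y` in a minimal space `Y` and extend `g <₀ ↦ g y`
continuously to `X_K` (`isFactor_orbitClosure`). The required uniform continuity rests on
`IsFlim.exists_mem_autGroup_agree`: if `g <₀` and `h <₀` agree on a large finite set, then `g` and
`h k`, for some `k ∈ G`, differ by a permutation near `1`, while `h k y = h y`. -/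

namespace RelExtAmenability

open Filter Topology

/-! ### Reducts and the Fraïssé limit of `K₀` -/

section Fraisse

variable {L₀ : FirstOrder.Language.{u, v}}

/-- The reduct to `L₀` of a structure in `L₀ ∪ {<}`. -/
@[reducible] def reductStructure {M : Type*} (S : (L₀.sum ltLang).Structure M) : L₀.Structure M :=
  (LHom.sumInl : L₀ →ᴸ L₀.sum ltLang).reduct M

/-- An embedding of reducts which respects `<` is an embedding. -/
def embeddingOfReduct {M N : Type*} (S : (L₀.sum ltLang).Structure M)
    (T : (L₀.sum ltLang).Structure N)
    (f : @FirstOrder.Language.Embedding L₀ M N (reductStructure S) (reductStructure T))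
    (h : ∀ a b, ltOf S a b ↔ ltOf T (f a) (f b)) : M ↪[L₀.sum ltLang] N :=
  letI := reductStructure S
  letI := reductStructure T
  { toEmbedding := f.toEmbedding
    map_fun' := by
      rintro n (g | g) x
      · exact f.map_fun g x
      · exact g.elim
    map_rel' := by
      rintro n (R | R) x
      · exact f.map_rel R x
      · cases R
        have hx : x = ![x 0, x 1] := by ext i; fin_cases i <;> rfl
        have hx' : f ∘ x = ![f (x 0), f (x 1)] := by ext i; fin_cases i <;> rfl
        change T.RelMap _ (f ∘ x) ↔ _
        rw [hx', hx]
        exact (h _ _).symm }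

/-- The embedding of reducts that underlies an embedding. -/
def reductEmbedding {M N : Type*} (S : (L₀.sum ltLang).Structure M)
    (T : (L₀.sum ltLang).Structure N) (f : M ↪[L₀.sum ltLang] N) :
    @FirstOrder.Language.Embedding L₀ M N (reductStructure S) (reductStructure T) :=
  letI := reductStructure S
  letI := reductStructure T
  { toEmbedding := f.toEmbedding
    map_fun' := fun g x => f.map_fun (Sum.inl g) x
    map_rel' := fun R x => f.map_rel (Sum.inl R) x }

theorem ltOf_embedding {M N : Type*} (S : (L₀.sum ltLang).Structure M)
    (T : (L₀.sum ltLang).Structure N) (f : M ↪[L₀.sum ltLang] N) (a b : M) :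
    ltOf S a b ↔ ltOf T (f a) (f b) := by
  have h := f.map_rel (Sum.inr LtRel.lt : (L₀.sum ltLang).Relations 2) ![a, b]
  have hx : f ∘ ![a, b] = ![f a, f b] := by ext i; fin_cases i <;> rfl
  rw [hx] at h
  exact h.symm

theorem fg_of_fg_reduct {M : Type*} (S : (L₀.sum ltLang).Structure M)
    (h : @Structure.FG L₀ M (reductStructure S)) : Structure.FG (L₀.sum ltLang) M := by
  let _ := reductStructure S
  have : (LHom.sumInl : L₀ →ᴸ L₀.sum ltLang).IsExpansionOn M := ⟨fun _ _ => rfl, fun _ _ => rfl⟩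
  obtain ⟨s, hs, hs'⟩ := Substructure.fg_def.1 h.out
  refine ⟨Substructure.fg_def.2 ⟨s, hs, ?_⟩⟩
  have : Substructure.closure L₀ s ≤ (LHom.sumInl : L₀ →ᴸ L₀.sum ltLang).substructureReduct
      (Substructure.closure (L₀.sum ltLang) s) :=
    Substructure.closure_le.2 Substructure.subset_closure
  rw [hs'] at this
  exact eq_top_iff.2 fun x _ => this (Substructure.mem_top x)

variable [Countable (Σ l, L₀.Functions l)] {K₀ : Set (Bundled.{w} L₀.Structure)}
  {K : Set (Bundled.{w} (L₀.sum ltLang).Structure)} {F : Type w} [Countable F]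
  {F₀ : L₀.Structure F} {lt₀ : LO F}

theorem expand_mem_of_embedding (hF : IsFlim K (expand F₀ lt₀.rel)) {N : Type w}
    (S : L₀.Structure N) (hfg : Structure.FG L₀ N) (e : N ↪[L₀] F) :
    (⟨N, expand S fun a b => lt₀.rel (e a) (e b)⟩ : Bundled.{w} (L₀.sum ltLang).Structure) ∈ K := by
  let _ : (L₀.sum ltLang).Structure F := expand F₀ lt₀.rel
  rw [← hF.age]
  exact ⟨fg_of_fg_reduct _ hfg, ⟨embeddingOfReduct _ (expand F₀ lt₀.rel) e fun a b => Iff.rfl⟩⟩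

theorem IsFlim.age_reduct (hK₀ : IsFraisseClass K₀) (hK : IsOrderFraisseExpansion K₀ K)
    (hF : IsFlim K (expand F₀ lt₀.rel)) : L₀.age F = K₀ := by
  let _ : (L₀.sum ltLang).Structure F := expand F₀ lt₀.rel
  ext N
  refine ⟨?_, fun hN => ⟨hK₀.isFraisse.FG N hN, ?_⟩⟩
  · rintro ⟨hfg, ⟨e⟩⟩
    rw [← hK.reducts]
    exact ⟨_, expand_mem_of_embedding hF N.str hfg e, rfl⟩
  · rw [← hK.reducts] at hN
    obtain ⟨A, hA, rfl⟩ := hN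
    rw [← hF.age] at hA
    obtain ⟨-, ⟨e⟩⟩ := hA
    exact ⟨reductEmbedding _ (expand F₀ lt₀.rel) e⟩

theorem isStrictTotalOrder_comp {M N : Type*} {r : N → N → Prop} (h : IsStrictTotalOrder N r)
    {f : M → N} (hf : Function.Injective f) : IsStrictTotalOrder M fun a b => r (f a) (f b) :=
  (RelEmbedding.preimage ⟨f, hf⟩ r).isStrictTotalOrder

/-- One-point extension, the only place where reasonableness enters: it makes the larger structure a
member of `K`, where the homogeneity of `F` is available. -/
theorem IsFlim.isExtensionPair_reduct (hK₀ : IsFraisseClass K₀)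
    (hK : IsOrderFraisseExpansion K₀ K) (hF : IsFlim K (expand F₀ lt₀.rel)) :
    L₀.IsExtensionPair F F := by
  let _ : (L₀.sum ltLang).Structure F := expand F₀ lt₀.rel
  rw [isExtensionPair_iff_exists_embedding_closure_singleton_sup]
  intro S hS f m
  set T := Substructure.closure L₀ {m} ⊔ S
  have hTfg : T.FG := (Substructure.fg_closure_singleton m).sup hS
  have hage := hF.age_reduct hK₀ hK
  have hSK : (⟨S, inferInstance⟩ : Bundled.{w} L₀.Structure) ∈ K₀ :=
    hage ▸ age.fg_substructure hS
  have hTK : (⟨T, inferInstance⟩ : Bundled.{w} L₀.Structure) ∈ K₀ :=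
    hage ▸ age.fg_substructure hTfg
  have hSfg := (Substructure.fg_iff_structure_fg _).1 hS
  obtain ⟨r', -, hr'K, hr'⟩ := hK.reasonable _ hSK _ hTK (Substructure.inclusion le_sup_right)
    (fun a b => lt₀.rel (f a) (f b)) (isStrictTotalOrder_comp lt₀.2 f.injective)
    (expand_mem_of_embedding hF inferInstance hSfg f)
  rw [← hF.age] at hr'K
  obtain ⟨-, hne⟩ := hr'K
  let SS : (L₀.sum ltLang).Structure S :=
    expand inferInstance fun a b => lt₀.rel (f a) (f b)
  let ST : (L₀.sum ltLang).Structure T := expand inferInstance r'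
  -- The age gives only some embedding of `⟨T, r'⟩` into `F`; ultrahomogeneity corrects it to one
  -- that extends `f`.
  obtain ⟨f', hf'⟩ := hF.ultrahomogeneous.extend_embedding (fg_of_fg_reduct SS hSfg)
    (h := hne) (embeddingOfReduct SS (expand F₀ lt₀.rel) f fun a b => Iff.rfl)
    (embeddingOfReduct SS ST (Substructure.inclusion le_sup_right) hr')
  refine ⟨reductEmbedding ST (expand F₀ lt₀.rel) f', ?_⟩
  ext x
  exact DFunLike.congr_fun hf' x

theorem IsFlim.reduct (hK₀ : IsFraisseClass K₀) (hK : IsOrderFraisseExpansion K₀ K)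
    (hF : IsFlim K (expand F₀ lt₀.rel)) : IsFlim K₀ F₀ where
  ultrahomogeneous := (isUltrahomogeneous_iff_IsExtensionPair
    (Structure.cg_of_countable)).2 (hF.isExtensionPair_reduct hK₀ hK)
  age := hF.age_reduct hK₀ hK

/-- Ultrahomogeneity of `⟨F₀, <₀⟩` on finite `L₀`-substructures. -/
theorem IsFlim.exists_automorphism (hF : IsFlim K (expand F₀ lt₀.rel)) (S : L₀.Substructure F)
    (hS : S.FG) (f : S ↪[L₀] F) (hf : ∀ a b : S, lt₀.rel a b ↔ lt₀.rel (f a) (f b)) :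
    ∃ k ∈ autGroup (L₀.sum ltLang) (expand F₀ lt₀.rel), ∀ a : S, k a = f a := by
  let _ : (L₀.sum ltLang).Structure F := expand F₀ lt₀.rel
  -- The symbol `<` adds no functions, so `S` is already closed under the larger signature.
  let S' : (L₀.sum ltLang).Substructure F :=
    { carrier := S
      fun_mem := by
        rintro n (g | g)
        · exact S.fun_mem g
        · exact g.elim }
  let SS : (L₀.sum ltLang).Structure S' := inferInstance
  have hfg : S'.FG := (Substructure.fg_iff_structure_fg _).2
    (fg_of_fg_reduct SS ((Substructure.fg_iff_structure_fg _).1 hS))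
  obtain ⟨g, hg⟩ := hF.ultrahomogeneous S' hfg (embeddingOfReduct SS (expand F₀ lt₀.rel) f hf)
  exact ⟨g.toEquiv, ⟨g, rfl⟩, fun a => (DFunLike.congr_fun hg a).symm⟩

end Fraisse

/-! ### Minimal subspaces, fixed points and uniformity of actions -/

section Dynamics

variable {G : Type*} [Group G] [TopologicalSpace G] {X : Type*} [TopologicalSpace X]
  [MulAction G X]

/-- A closed invariant nonempty subset of a `G`-space is a `G`-space. -/
theorem IsGSpace.of_isClosed (hX : IsGSpace G X) (C : SubMulAction G X)
    (hC : IsClosed (C : Set X)) (hne : (C : Set X).Nonempty) : IsGSpace G C where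
  nonempty := hne.to_subtype
  compact := haveI := hX.compact; isCompact_iff_compactSpace.1 hC.isCompact
  hausdorff := haveI := hX.hausdorff; inferInstanceAs (T2Space (C : Set X))
  continuous_smul := haveI := hX.continuous_smul
    ⟨Continuous.subtype_mk (continuous_fst.smul (continuous_subtype_val.comp continuous_snd)) _⟩

/-- Every `G`-space contains a minimal one. -/
theorem IsGSpace.exists_minimal (hX : IsGSpace G X) :
    ∃ C : SubMulAction G X, IsClosed (C : Set X) ∧ IsMinimalGSpace G C := by
  have := hX.compact
  have := hX.nonempty
  let S : Set (Set X) := {C | IsClosed C ∧ C.Nonempty ∧ ∀ g : G, ∀ x ∈ C, g • x ∈ C}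
  obtain ⟨M, -, hM⟩ := zorn_superset_nonempty S (by
    intro c hcS hc hcne
    refine ⟨⋂₀ c, ⟨isClosed_sInter fun t ht => (hcS ht).1, ?_, ?_⟩, fun t ht =>
      Set.sInter_subset_of_mem ht⟩
    · have := hcne.to_subtype
      exact IsCompact.nonempty_sInter_of_directed_nonempty_isCompact_isClosed
        (fun a ha b hb => (hc.total ha hb).elim (fun h => ⟨a, ha, subset_rfl, h⟩)
          fun h => ⟨b, hb, h, subset_rfl⟩) (fun t ht => (hcS ht).2.1) (fun t ht => (hcS ht).1.isCompact)
        (fun t ht => (hcS ht).1)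
    · exact fun g x hx t ht => (hcS ht).2.2 g x (hx t ht)) Set.univ
    ⟨isClosed_univ, Set.univ_nonempty, fun _ _ _ => trivial⟩
  let C : SubMulAction G X := ⟨M, fun g x hx => hM.prop.2.2 g x hx⟩
  refine ⟨C, hM.prop.1, hX.of_isClosed C hM.prop.1 hM.prop.2.1, fun D hD hinv => ?_⟩
  rcases D.eq_empty_or_nonempty with h | h
  · exact Or.inl h
  refine Or.inr (Set.eq_univ_of_forall fun x => ?_)
  have hD' : Subtype.val '' D ∈ S := by
    refine ⟨hM.prop.1.isClosedEmbedding_subtypeVal.isClosedMap D hD, h.image _, ?_⟩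
    rintro g _ ⟨y, hy, rfl⟩
    exact ⟨g • y, hinv g y hy, rfl⟩
  obtain ⟨y, hy, hyx⟩ := hM.le_of_le hD' (fun _ ⟨y, _, h⟩ => h ▸ y.2) x.2
  rwa [← Subtype.ext hyx]

theorem IsMinimalGSpace.closure_orbit (hX : IsMinimalGSpace G X) (x : X) :
    closure (MulAction.orbit G x) = Set.univ := by
  have := hX.isGSpace.continuous_smul
  refine (hX.minimal _ isClosed_closure fun g y hy => ?_).resolve_left
    ((MulAction.nonempty_orbit x).closure.ne_empty)
  exact map_mem_closure (continuous_const_smul g) hy fun z hz =>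
    MulAction.mem_orbit_of_mem_orbit g hz

/-- Moves the fixed-point property across universes, by transport to a copy of `X` in `Type s`. -/
theorem RelativelyExtremelyAmenable.exists_fixed {H : Subgroup G}
    (h : RelativelyExtremelyAmenable.{s} G H) [Small.{s} X] (hX : IsGSpace G X) :
    ∃ x : X, ∀ g ∈ H, g • x = x := by
  let e : Shrink.{s} X ≃ X := (equivShrink X).symm
  let _ : TopologicalSpace (Shrink.{s} X) := .induced e inferInstance
  let _ : MulAction G (Shrink.{s} X) := e.mulAction G
  let e' : Shrink.{s} X ≃ₜ X := e.toHomeomorphOfIsInducing ⟨rfl⟩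
  have := hX.nonempty
  have := hX.compact
  have := hX.hausdorff
  have := hX.continuous_smul
  obtain ⟨x, hx⟩ := h (Shrink.{s} X) ⟨e.nonempty, e'.symm.compactSpace, e'.symm.t2Space,
    ⟨e'.symm.continuous.comp (continuous_fst.smul (e'.continuous.comp continuous_snd))⟩⟩
  exact ⟨e' x, fun g hg => e'.symm_apply_eq.1 (hx g hg)⟩

/-- The action on a compact space is uniformly close to the identity near `1`. -/
theorem eventually_smul_mem_uniformity {Y : Type*} [UniformSpace Y] [CompactSpace Y]
    [MulAction G Y] [ContinuousSMul G Y] {U : Set (Y × Y)} (hU : U ∈ uniformity Y) :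
    ∀ᶠ g : G in 𝓝 1, ∀ y : Y, (y, g • y) ∈ U := by
  -- Tube lemma: compactness of `Y` makes the neighbourhood of `1` independent of `y`.
  have := isCompact_univ.eventually_forall_of_forall_eventually (x₀ := (1 : G))
    (P := fun g (y : Y) => (y, g • y) ∈ U) fun y _ => ?_
  · simpa using this
  · have hc : Continuous fun z : G × Y => (z.2, z.1 • z.2) := by fun_prop
    refine hc.continuousAt.eventually_mem ?_
    simpa using nhds_le_uniformity y hU

end Dynamics

/-! ### Permutation groups acting on the compact space of orders -/

section Orders

variable {M : Type w}

theorem continuous_perm_apply (a : M) :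
    letI : TopologicalSpace M := ⊥; Continuous fun σ : Equiv.Perm M => σ a :=
  letI : TopologicalSpace M := ⊥
  continuous_iInf_dom (i := a) continuous_induced_dom

theorem isOpen_setOf_perm_apply_eq (a b : M) : IsOpen {σ : Equiv.Perm M | σ a = b} := by
  let _ : TopologicalSpace M := ⊥
  have : DiscreteTopology M := ⟨rfl⟩
  exact (isOpen_discrete {b}).preimage (continuous_perm_apply a)

/-- The pointwise stabilizers of finite sets form a neighbourhood basis at `1`. -/
theorem exists_finite_of_mem_nhds_one {W : Set (Equiv.Perm M)} (hW : W ∈ 𝓝 1) :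
    ∃ A : Set M, A.Finite ∧ ∀ σ : Equiv.Perm M, (∀ a ∈ A, σ a = a) → σ ∈ W := by
  rw [nhds_iInf, mem_iInf] at hW
  obtain ⟨A, hA, V, hV, rfl⟩ := hW
  refine ⟨A, hA, fun σ hσ => Set.mem_iInter.2 fun a => ?_⟩
  have := hV a
  rw [@nhds_induced, mem_comap] at this
  obtain ⟨t, ht, htV⟩ := this
  exact htV (by simpa [hσ a a.2] using @mem_of_mem_nhds _ ⊥ _ _ ht)

instance : T2Space (LO M) := inferInstanceAs (T2Space {_r : M × M → Bool // _})

instance : CompactSpace (LO M) := by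
  refine isCompact_iff_compactSpace.1 (IsClosed.isCompact (s := {r : M × M → Bool |
    IsStrictTotalOrder M (fun a b => r (a, b) = true)}) ?_)
  -- Each instance of an order axiom constrains at most three coordinates, hence is a closed
  -- condition.
  have heq : {r : M × M → Bool | IsStrictTotalOrder M (fun a b => r (a, b) = true)} =
      {r | (∀ a b, r (a, b) = true ∨ r (b, a) = true ∨ a = b) ∧ (∀ a, ¬ r (a, a) = true) ∧
        ∀ a b c, ¬ r (a, b) = true ∨ ¬ r (b, c) = true ∨ r (a, c) = true} := by
    ext r
    constructor
    · intro h
      refine ⟨fun a b => ?_, fun a => h.irrefl a, fun a b c => ?_⟩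
      · have := h.trichotomous a b
        tauto
      · have := h.trans a b c
        tauto
    · rintro ⟨h1, h2, h3⟩
      exact { trichotomous := fun a b => by have := h1 a b; tauto
              irrefl := h2
              trans := fun a b c => by have := h3 a b c; tauto }
  have hcl : ∀ (p : M × M) , IsClopen {r : M × M → Bool | r p = true} := fun p =>
    (isClopen_discrete {true}).preimage (continuous_apply p)
  rw [heq]
  simp only [Set.ofPred_and, Set.ofPred_forall, Set.ofPred_or]
  refine ((isClosed_iInter fun a => isClosed_iInter fun b => ?_).inter
    ((isClosed_iInter fun a => ?_).inter
      (isClosed_iInter fun a => isClosed_iInter fun b => isClosed_iInter fun c => ?_)))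
  · exact (hcl _).1.union ((hcl _).1.union isClosed_const)
  · exact (hcl _).compl.1
  · exact (hcl _).compl.1.union ((hcl _).compl.1.union (hcl _).1)

/-- Basic neighbourhoods in `LO(M)`: the orders that agree with `r` on a finite set. -/
theorem eventually_agree (r : LO M) {A : Set M} (hA : A.Finite) :
    ∀ᶠ r' in 𝓝 r, ∀ a ∈ A, ∀ b ∈ A, (r'.rel a b ↔ r.rel a b) := by
  simp only [hA.eventually_all]
  intro a _ b _
  have hc : Continuous fun r' : LO M => r'.1 (a, b) :=
    (continuous_apply (a, b)).comp continuous_subtype_val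
  filter_upwards [hc.continuousAt.eventually_mem (IsOpen.mem_nhds (isOpen_discrete {r.1 (a, b)}) rfl)]
    with r' hr'
  simp only [LO.rel, Set.mem_singleton_iff.1 hr']

instance : ContinuousSMul (Equiv.Perm M) (LO M) where
  continuous_smul := by
    refine Continuous.subtype_mk (continuous_pi fun p => ?_) _
    refine continuous_iff_continuousAt.2 fun z => ?_
    -- Inversion is locally constant at each point: `σ⁻¹ a = b` is the open condition `σ b = a`.
    have h1 : ∀ a, ∀ᶠ z' : Equiv.Perm M × LO M in 𝓝 z, z'.1⁻¹ a = z.1⁻¹ a := fun a => by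
      have := (isOpen_setOf_perm_apply_eq (z.1⁻¹ a) a).preimage
        (continuous_fst (X := Equiv.Perm M) (Y := LO M))
      filter_upwards [this.mem_nhds (by simp)] with z' hz'
      rw [Equiv.Perm.inv_eq_iff_eq]
      exact hz'.symm
    have hc : Continuous fun z' : Equiv.Perm M × LO M => z'.2.1 (z.1⁻¹ p.1, z.1⁻¹ p.2) :=
      (continuous_apply _).comp (continuous_subtype_val.comp continuous_snd)
    refine hc.continuousAt.congr ?_
    filter_upwards [h1 p.1, h1 p.2] with z' e1 e2
    rw [e1, e2]

theorem isGSpace_orbitClosure (H : Subgroup (Equiv.Perm M)) (r : LO M) :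
    IsGSpace H (orbitClosure H r) := by
  have hLO : IsGSpace H (LO M) := ⟨⟨r⟩, inferInstance, inferInstance, inferInstance⟩
  exact hLO.of_isClosed _ isClosed_closure (MulAction.nonempty_orbit r).closure

instance [Countable M] : Small.{s} (LO M) :=
  small_of_injective (β := M × M → Bool) Subtype.val_injective

end Orders

/-! ### Extending the orbit map to the orbit closure -/

section Extension

variable {M : Type w}

theorem mem_subgroup_nhds_one {H : Subgroup (Equiv.Perm M)} {W : Set H} (hW : W ∈ 𝓝 1) :
    ∃ A : Set M, A.Finite ∧ ∀ σ : H, (∀ a ∈ A, (σ : Equiv.Perm M) a = a) → σ ∈ W := by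
  rw [nhds_subtype_eq_comap, mem_comap] at hW
  obtain ⟨t, ht, htW⟩ := hW
  obtain ⟨A, hA, hAt⟩ := exists_finite_of_mem_nhds_one ht
  exact ⟨A, hA, fun σ hσ => htW (hAt σ hσ)⟩

/-- If `h` and `g` move `r` to orders which agree on a suitable finite set, then they differ by an
element of `S` up to a permutation fixing a prescribed finite set. Under this hypothesis, the closure
of the orbit of `r` maps onto every minimal space with an `S`-fixed point. -/
theorem isFactor_orbitClosure {H : Subgroup (Equiv.Perm M)} {S : Subgroup H} {r : LO M}
    (hS : ∀ A : Set M, A.Finite → ∃ B : Set M, B.Finite ∧ ∀ g h : H,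
      (∀ a ∈ B, ∀ b ∈ B, ((g • r).rel a b ↔ (h • r).rel a b)) →
      ∃ k ∈ S, ∀ a ∈ A, ((h * k * g⁻¹ : H) : Equiv.Perm M) a = a)
    {Y : Type*} [TopologicalSpace Y] [MulAction H Y] (hY : IsMinimalGSpace H Y) {y : Y}
    (hy : ∀ k ∈ S, k • y = y) : IsFactor H (orbitClosure H r) Y := by
  have := hY.isGSpace.compact
  have := hY.isGSpace.hausdorff
  have := hY.isGSpace.continuous_smul
  have := (isGSpace_orbitClosure H r).compact
  have := (isGSpace_orbitClosure H r).continuous_smul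
  let _ : UniformSpace Y := uniformSpaceOfCompactR1
  let x₀ : orbitClosure H r := ⟨r, subset_closure (MulAction.mem_orbit_self r)⟩
  -- Uniform continuity of `g • r ↦ g • y`: as `k` fixes `y`, `h • y = (h * k * g⁻¹) • (g • y)`, and
  -- the factor `h * k * g⁻¹` is near `1`.
  have hunif : ∀ U ∈ uniformity Y, ∃ B : Set M, B.Finite ∧ ∀ g h : H,
      (∀ a ∈ B, ∀ b ∈ B, ((g • r).rel a b ↔ (h • r).rel a b)) → (g • y, h • y) ∈ U := by
    intro U hU
    obtain ⟨A, hA, hAU⟩ := mem_subgroup_nhds_one (eventually_smul_mem_uniformity (G := H) hU)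
    obtain ⟨B, hB, hBA⟩ := hS A hA
    refine ⟨B, hB, fun g h hgh => ?_⟩
    obtain ⟨k, hk, hkA⟩ := hBA g h hgh
    have := hAU _ hkA (g • y)
    rwa [smul_smul, inv_mul_cancel_right, mul_smul, hy k hk] at this
  have hdense : DenseRange (Subtype.val : MulAction.orbit H x₀ → orbitClosure H r) := by
    rw [DenseRange, Subtype.range_coe]
    intro x
    rw [closure_subtype]
    have : Subtype.val '' MulAction.orbit H x₀ = MulAction.orbit H r := by
      rw [MulAction.orbit, MulAction.orbit, ← Set.range_comp]; rfl
    rw [this]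
    exact x.2
  have hdi : IsDenseInducing (Subtype.val : MulAction.orbit H x₀ → orbitClosure H r) :=
    ⟨⟨rfl⟩, hdense⟩
  -- The representative is arbitrary; `hunif` and the Hausdorff property later show that `γ d • y`
  -- does not depend on it.
  choose γ hγ using fun d : MulAction.orbit H x₀ => MulAction.mem_orbit_iff.1 d.2
  have hγr : ∀ d, γ d • r = d.1.1 := fun d => congrArg Subtype.val (hγ d)
  let f : MulAction.orbit H x₀ → Y := fun d => γ d • y
  have hcont : Continuous (hdi.extend f) := by
    refine hdi.continuous_extend fun x => CompleteSpace.complete (f := map f _) ?_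
    have := hdi.comap_nhds_neBot x
    refine cauchy_map_iff.2 ⟨this, ?_⟩
    intro U hU
    obtain ⟨B, hB, hBU⟩ := hunif U hU
    have hev : ∀ᶠ d in comap (Subtype.val : MulAction.orbit H x₀ → _) (𝓝 x),
        ∀ a ∈ B, ∀ b ∈ B, (d.1.1.rel a b ↔ x.1.rel a b) :=
      (continuous_subtype_val.tendsto x |>.eventually (eventually_agree x.1 hB)).comap _
    refine mem_map.2 ?_
    filter_upwards [hev.prod_mk hev] with d hd
    refine hBU _ _ fun a ha b hb => ?_
    rw [hγr, hγr, hd.1 a ha b hb, hd.2 a ha b hb]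
  have hval : ∀ g : H, hdi.extend f (g • x₀) = g • y := by
    intro g
    have hg : ∀ d : MulAction.orbit H x₀, ∀ g : H, g • x₀ = d.1 → f d = g • y := by
      intro d g hgd
      refine eq_of_uniformity fun {U} hU => ?_
      obtain ⟨B, -, hBU⟩ := hunif U hU
      refine hBU _ _ fun a _ b _ => ?_
      have e : γ d • r = g • r := congrArg Subtype.val ((hγ d).trans hgd.symm)
      rw [e]
    have hfc : Continuous f := by
      refine continuous_iff_continuousAt.2 fun d => Uniform.tendsto_nhds_right.2 fun U hU => ?_
      obtain ⟨B, hB, hBU⟩ := hunif U hU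
      have hc : Continuous fun d : MulAction.orbit H x₀ => d.1.1 :=
        continuous_subtype_val.comp continuous_subtype_val
      refine mem_map.2 ?_
      filter_upwards [(hc.tendsto d).eventually (eventually_agree d.1.1 hB)] with d' hd'
      refine hBU _ _ fun a ha b hb => ?_
      rw [hγr, hγr, hd' a ha b hb]
    have := hdi.extend_eq hfc ⟨g • x₀, MulAction.mem_orbit _ g⟩
    rw [this]
    exact hg _ g rfl
  have hequiv : ∀ (g : H) (x : orbitClosure H r), hdi.extend f (g • x) = g • hdi.extend f x := by
    intro g x
    have h1 : Continuous fun x => hdi.extend f (g • x) := hcont.comp (continuous_const_smul g)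
    have h2 : Continuous fun x => g • hdi.extend f x := hcont.const_smul g
    refine congrFun (hdense.equalizer h1 h2 ?_) x
    ext ⟨_, h, rfl⟩
    simp only [Function.comp, smul_smul, hval]
  refine ⟨_, hcont, ?_, hequiv⟩
  -- The image is compact, invariant and nonempty, so minimality of `Y` makes it everything.
  rw [← Set.range_eq_univ]
  refine (hY.minimal _ (isCompact_range hcont).isClosed ?_).resolve_left
    (Set.range_nonempty_iff_nonempty.2 ⟨x₀⟩).ne_empty
  rintro g _ ⟨x, rfl⟩
  exact ⟨g • x, hequiv g x⟩

end Extension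

/-! ### Agreement of orders and automorphisms of `F` -/

section Main

variable {L₀ : FirstOrder.Language.{u, v}} {F : Type w} {F₀ : L₀.Structure F} {lt₀ : LO F}

theorem autGroup_expand_le :
    autGroup (L₀.sum ltLang) (expand F₀ lt₀.rel) ≤ autGroup L₀ F₀ := by
  let _ : (L₀.sum ltLang).Structure F := expand F₀ lt₀.rel
  rintro _ ⟨e, rfl⟩
  exact ⟨{ toEquiv := e.toEquiv
           map_fun' := fun g x => e.map_fun' (Sum.inl g) x
           map_rel' := fun R x => e.map_rel' (Sum.inl R) x }, rfl⟩

theorem smul_eq_of_mem_autGroup {σ : Equiv.Perm F}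
    (h : σ ∈ autGroup (L₀.sum ltLang) (expand F₀ lt₀.rel)) : σ • lt₀ = lt₀ := by
  let _ : (L₀.sum ltLang).Structure F := expand F₀ lt₀.rel
  obtain ⟨e, he⟩ := inv_mem h
  refine Subtype.ext (funext fun p => Bool.eq_iff_iff.2 ?_)
  have := (ltOf_embedding _ (expand F₀ lt₀.rel) e.toEmbedding p.1 p.2).symm
  change lt₀.rel (σ⁻¹ p.1) (σ⁻¹ p.2) ↔ lt₀.rel p.1 p.2
  rw [← he]
  exact this

variable [Countable (Σ l, L₀.Functions l)] {K₀ : Set (Bundled.{w} L₀.Structure)}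
  {K : Set (Bundled.{w} (L₀.sum ltLang).Structure)} [Countable F]

/-- Take for `B` the substructure generated by `A`, finite because it lies in `K₀`. Agreement on `B`
says that `h⁻¹ g` preserves `<₀` on `g⁻¹ B`, so it extends from there to some `k ∈ G`; then `h k
g⁻¹` fixes `B` pointwise. -/
theorem IsFlim.exists_mem_autGroup_agree (hK₀ : IsFraisseClass K₀) (hF₀ : IsFlim K₀ F₀)
    (hF : IsFlim K (expand F₀ lt₀.rel)) (A : Set F) (hA : A.Finite) :
    ∃ B : Set F, B.Finite ∧ ∀ g h : autGroup L₀ F₀,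
      (∀ a ∈ B, ∀ b ∈ B, ((g • lt₀).rel a b ↔ (h • lt₀).rel a b)) →
      ∃ k ∈ (autGroup (L₀.sum ltLang) (expand F₀ lt₀.rel)).subgroupOf (autGroup L₀ F₀),
        ∀ a ∈ A, ((h * k * g⁻¹ : autGroup L₀ F₀) : Equiv.Perm F) a = a := by
  set T := Substructure.closure L₀ A
  have hTfg : T.FG := Substructure.fg_closure hA
  have hTfin : Finite T := hK₀.finite _ (hF₀.age ▸ age.fg_substructure hTfg)
  refine ⟨T, Set.toFinite _, ?_⟩
  rintro ⟨_, eg, rfl⟩ ⟨_, eh, rfl⟩ hgh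
  let S : L₀.Substructure F := T.map eg.symm.toHom
  have hST : ∀ x : S, eg x ∈ T := by
    rintro ⟨_, y, hy, rfl⟩
    simpa using hy
  obtain ⟨k, hk, hkS⟩ := hF.exists_automorphism S (hTfg.map _)
    ((eh.symm.comp eg).toEmbedding.comp S.subtype) fun a b => by
      have := hgh _ (hST a) _ (hST b)
      change lt₀.rel (eg.symm (eg a)) (eg.symm (eg b)) ↔
        lt₀.rel (eh.symm (eg a)) (eh.symm (eg b)) at this
      simpa using this
  refine ⟨⟨k, autGroup_expand_le hk⟩, hk, fun a ha => ?_⟩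
  have := hkS ⟨eg.symm a, a, Substructure.subset_closure ha, rfl⟩
  change eh (k (eg.symm a)) = a
  rw [this]
  simp

end Main

end RelExtAmenability

theorem mainTheorem3 {L₀ : FirstOrder.Language.{u, v}} [Countable (Σ l, L₀.Functions l)]
    (K₀ : Set (Bundled.{w} L₀.Structure)) (hK₀ : IsFraisseClass K₀)
    (K : Set (Bundled.{w} (L₀.sum ltLang).Structure)) (hK : IsOrderFraisseExpansion K₀ K)
    -- the Fraïssé limit of `K`, in the form `F = ⟨F₀, <₀⟩`
    (F : Type w) [Countable F] (F₀ : L₀.Structure F) (lt₀ : LO F)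
    (hF : IsFlim K (expand F₀ lt₀.rel))
    -- `G₀ = Aut(F₀)`, its subgroup `G = Aut(F)`, and `X_K`
    (G₀ : Subgroup (Equiv.Perm F)) (hG₀ : G₀ = autGroup L₀ F₀)
    (G : Subgroup G₀) (hG : G = (autGroup (L₀.sum ltLang) (expand F₀ lt₀.rel)).subgroupOf G₀)
    (X : SubMulAction G₀ (LO F)) (hX : X = orbitClosure G₀ lt₀) :
    IsFlim K₀ F₀ ∧
      (IsUniversalMinimalSpace.{s} G₀ X ↔
        RelativelyExtremelyAmenable.{s} G₀ G ∧ IsTransitiveWrt G₀ (fixSet G X)) := by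

  subst hG₀ hG hX
  have hF₀ := hF.reduct hK₀ hK
  refine ⟨hF₀, ?_⟩
  have hX := isGSpace_orbitClosure (autGroup L₀ F₀) lt₀
  constructor
  · intro h
    refine ⟨fun Y _ _ hY => ?_, fun x _ => h.isMinimal.closure_orbit x⟩
    obtain ⟨C, -, hC⟩ := hY.exists_minimal
    obtain ⟨φ, -, -, hφ⟩ := h.isUniversal.universal C hC
    -- `<₀` is itself `G`-fixed, and equivariant maps preserve fixed points.
    refine ⟨φ ⟨lt₀, subset_closure (MulAction.mem_orbit_self lt₀)⟩, fun k hk => ?_⟩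
    rw [← SubMulAction.val_smul, ← hφ]
    exact congrArg (fun x => (φ x : Y)) (Subtype.ext (smul_eq_of_mem_autGroup hk))
  · rintro ⟨hrea, htr⟩
    refine ⟨⟨hX, ?_⟩, hX, fun Y _ _ hY => ?_⟩
    · intro C hC hinv
      rcases C.eq_empty_or_nonempty with h | h
      · exact Or.inl h
      let C' : SubMulAction (autGroup L₀ F₀) (orbitClosure (autGroup L₀ F₀) lt₀) :=
        ⟨C, fun g _ hx => hinv g _ hx⟩
      -- Countability of `F` makes `LO(F)` small in every universe, so amenability over `Type s`
      -- applies.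
      have : Small.{s} C' := small_of_injective (Subtype.val_injective.comp Subtype.val_injective :
        Function.Injective fun x : C' => (x.1.1 : LO F))
      obtain ⟨x, hx⟩ := hrea.exists_fixed (hX.of_isClosed C' hC h)
      refine Or.inr (Set.univ_subset_iff.1 ?_)
      rw [← htr x fun g hg => congrArg Subtype.val (hx g hg)]
      refine hC.closure_subset_iff.2 ?_
      rintro _ ⟨g, rfl⟩
      exact hinv g _ x.2
    · obtain ⟨y, hy⟩ := hrea Y hY.isGSpace
      exact isFactor_orbitClosure (IsFlim.exists_mem_autGroup_agree hK₀ hF₀ hF) hY hy
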